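/- Let $\mathcal{X}$ be a measurable space. A domain $\mathcal{D}$ consists of a probability distribution on $\mathcal{X}$, also denoted by $\mathcal{D}$, and a measurable labeling function $f_{\mathcal{D}}:\mathcal{X}\to\{0,1\}$. The risk of a hypothesis $h:\mathcal{X}\to\{0,1\}$ is $\varepsilon_{\mathcal{D}}(h)=\Pr_{x\sim\mathcal{D}}(h(x)\neq f_{\mathcal{D}}(x))$. Let $\mathcal{H}$ be a class of measurable hypotheses with finite VC-dimension $d$, and let $\mathcal{S}_1,\dots,\mathcal{S}_M$ (the sources) and $\mathcal{T}$ (the target) be domains over $\mathcal{X}$. Let $n\ge 1$ be a multiple of $M$ and let $0<\delta<1$. Draw independently $n$ unlabeled points $t_1,\dots,t_n$ i.i.d. from $\mathcal{T}$ and, for each $j\in\{1,\dots,M\}$, $n/M$ labeled examples $(x_{j,i},y_{j,i})$ with $x_{j,i}$ i.i.d. from $\mathcal{S}_j$ and $y_{j,i}=f_{\mathcal{S}_j}(x_{j,i})$. Let $\widehat\varepsilon_{\mathcal{S}_j}(h)=\frac{M}{n}\sum_{i=1}^{n/M}\mathbf{1}[h(x_{j,i})\ne y_{j,i}]$, let $\mathcal{H}\Delta\mathcal{H}=\{x\mapsto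 h(x)\oplus h'(x): h,h'\in\mathcal{H}\}$ (with $\oplus$ the exclusive or), and let $$\widehat d_{\mathcal{H}\Delta\mathcal{H}}(\mathcal{S}_\alpha,\mathcal{T})=2\sup_{l\in\mathcal{H}\Delta\mathcal{H}}\Big|\sum_{j=1}^M\alpha_j\,\frac{M}{n}\sum_{i=1}^{n/M}l(x_{j,i})-\frac1n\sum_{i=1}^n l(t_i)\Big| .$$ Then for every $h\in\mathcal{H}$ and every $\alpha$ in the simplex $\Delta=\{\alpha\in\mathbb{R}^M:\alpha_j\ge 0,\ \sum_{j=1}^M\alpha_j=1\}$, with probability at least $1-\delta$ over the choice of samples, $$\varepsilon_{\mathcal{T}}(h)\le\sum_{j=1}^M\alpha_j\widehat\varepsilon_{\mathcal{S}_j}(h)+\frac12\widehat d_{\mathcal{H}\Delta\mathcal{H}}(\mathcal{S}_\alpha,\mathcal{T})+\lambda_\alpha+B_\alpha(\delta)+V(\delta),$$ where $$\lambda_\alpha=\inf_{h'\in\mathcal{H}}\Big(\sum_{j=1}^M\alpha_j\varepsilon_{\mathcal{S}_j}(h')+\varepsilon_{\mathcal{T}}(h')\Big),$$ $$B_\alpha(\delta)=2\sqrt{\frac{M\left(2d\log(2(n+1))+\log\frac8\delta\right)}{n}\sum_{j=1}^M\alpha_j^2},\qquad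 V(\delta)=2\sqrt{\frac{2d\log(2n)+\log\frac4\delta}{n}} .$$ -/

import Mathlib

open MeasureTheory

noncomputable section

namespace DomainAdaptation

/-- A hypothesis is a function `X → {0, 1}`, with `false = 0` and `true = 1`. -/
abbrev Hypothesis (X : Type*) := X → Bool

/-- `A` is shattered by `H`: every `0/1` pattern on `A` is realised by an element of `H`. -/
def Shatters {X : Type*} (H : Set (Hypothesis X)) (A : Finset X) : Prop :=
  ∀ B ⊆ A, ∃ h ∈ H, ∀ x ∈ A, (h x = true ↔ x ∈ B)

/-- The VC-dimension: the supremum of the cardinalities of the finite shattered sets. -/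
def vcDim {X : Type*} (H : Set (Hypothesis X)) : ℕ∞ :=
  ⨆ A : {A : Finset X // Shatters H A}, (A.1.card : ℕ∞)

/-- The symmetric difference class: all `x ↦ h x ⊕ h' x` with `h, h' ∈ H`. -/
def symmDiffClass {X : Type*} (H : Set (Hypothesis X)) : Set (Hypothesis X) :=
  {l | ∃ h ∈ H, ∃ h' ∈ H, ∀ x, l x = Bool.xor (h x) (h' x)}

/-- The divergence of two distributions with respect to a class `H`,
`2 sup_{h ∈ H} |P {h = 1} - Q {h = 1}|`. The distributions enter as real set functions, so that the
same definition covers true and empirical distributions. -/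
def hDivergence {X : Type*} (H : Set (Hypothesis X)) (P Q : Set X → ℝ) : ℝ :=
  2 * ⨆ h : H, |P {x | h.1 x = true} - Q {x | h.1 x = true}|

/-- The empirical distribution of a sample: the fraction of sample points lying in `A`. -/
def empirical {X : Type*} {n : ℕ} (x : Fin n → X) (A : Set X) : ℝ :=
  (∑ i, A.indicator (fun _ => (1 : ℝ)) (x i)) / n

/-- The `α`-weighted mixture of the set functions `P j`. -/
def mixture {X : Type*} {M : ℕ} (α : Fin M → ℝ) (P : Fin M → Set X → ℝ) (A : Set X) : ℝ :=
  ∑ j, α j * P j A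

/-- A domain with deterministic labels: a probability distribution of inputs together with a
measurable labeling function. -/
structure Domain (X : Type*) [MeasurableSpace X] where
  /-- the marginal distribution of inputs -/
  marginal : Measure X
  isProbabilityMeasure : IsProbabilityMeasure marginal
  /-- the labeling function -/
  label : X → Bool
  measurable_label : Measurable label

namespace Domain

variable {X : Type*} [MeasurableSpace X]

instance (D : Domain X) : IsProbabilityMeasure D.marginal := D.isProbabilityMeasure

/-- The joint distribution of a labeled example `(x, f x)`. -/
def joint (D : Domain X) : Measure (X × Bool) :=
  D.marginal.map fun x => (x, D.label x)

instance (D : Domain X) : IsProbabilityMeasure D.joint :=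
  Measure.isProbabilityMeasure_map (measurable_id.prodMk D.measurable_label).aemeasurable

/-- The risk of `h`: the probability that `h x` differs from the label of `x`. -/
def risk (D : Domain X) (h : Hypothesis X) : ℝ :=
  D.marginal.real {x | h x ≠ D.label x}

end Domain

/-- The empirical risk of `h` on a labeled sample: the fraction of misclassified examples. -/
def empiricalRisk {X : Type*} {m : ℕ} (z : Fin m → X × Bool) (h : Hypothesis X) : ℝ :=
  (∑ i, if h (z i).1 ≠ (z i).2 then (1 : ℝ) else 0) / m

/-- The data: for each of `M` source domains a labeled sample of size `m`, and an unlabeled sample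
of size `n`. -/
abbrev Data (X : Type*) (M m n : ℕ) := (Fin M → Fin m → X × Bool) × (Fin n → X)

/-- The law of the data: all examples are independent, the labeled examples of source `j` are
distributed according to `S j`, the unlabeled ones according to the marginal of `T`. -/
def dataLaw {X : Type*} [MeasurableSpace X] {M : ℕ} (m n : ℕ)
    (S : Fin M → Domain X) (T : Domain X) : Measure (Data X M m n) :=
  (Measure.pi fun j => Measure.pi fun _ : Fin m => (S j).joint).prod
    (Measure.pi fun _ : Fin n => T.marginal)

/-- The empirical symmetric-difference divergence between the `α`-mixture of the sources and the
target: the source mixture is estimated by the `α`-mixture of the empirical distributions. -/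
def empiricalMixtureDivergence {X : Type*} {M m n : ℕ} (H : Set (Hypothesis X)) (α : Fin M → ℝ)
    (ω : Data X M m n) : ℝ :=
  hDivergence (symmDiffClass H)
    (mixture α fun j => empirical fun i => (ω.1 j i).1) (empirical ω.2)

/-- The smallest combined risk over `H` on the `α`-mixture of the sources and on the target. -/
def combinedRisk {X : Type*} [MeasurableSpace X] {M : ℕ} (H : Set (Hypothesis X)) (α : Fin M → ℝ)
    (S : Fin M → Domain X) (T : Domain X) : ℝ :=
  ⨅ h : H, ((∑ j, α j * (S j).risk h.1) + T.risk h.1)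

/-- The term `B_α(δ)`. -/
def mixtureTerm {M : ℕ} (d n : ℕ) (α : Fin M → ℝ) (δ : ℝ) : ℝ :=
  2 * √((M * (2 * d * Real.log (2 * (n + 1)) + Real.log (8 / δ))) / n * ∑ j, α j ^ 2)

/-- The term `V(δ)`. -/
def divergenceTerm (d n : ℕ) (δ : ℝ) : ℝ :=
  2 * √((2 * d * Real.log (2 * n) + Real.log (4 / δ)) / n)

end DomainAdaptation

end

open MeasureTheory ProbabilityTheory
open scoped NNReal

namespace DomainAdaptation

/-! Both `h` and `α` are fixed before the sample is drawn, so no uniform convergence over `H` is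
needed. Fix `g ∈ H` nearly attaining the infimum that defines `combinedRisk`; it depends only on the
domains, not on the data. On the target, `h` errs at most where `g` errs or where `h` and `g`
disagree. Replace the true target frequency of `{h ≠ g}` by the empirical one (Hoeffding), move to
the source samples at the cost of half the empirical divergence, and there bound disagreement by the
empirical errors of `h` and `g`. The error of `h` is already the one in the bound; that of `g`
returns to its true risk by a second Hoeffding bound.

So only two tail events are discarded: `weighted_empiricalRisk_deviation` at `mixtureTerm` and
`empirical_lower_deviation` at half of `divergenceTerm`. The other half pays for the near-optimality
of `g`. -/

/-! ### Sub-Gaussian concentration of empirical frequencies. -/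

/-- A sum of centred functions of the coordinates is sub-Gaussian under a product measure. -/
lemma hasSubgaussianMGF_pi_sum {ι : Type*} [Fintype ι] {Ω : ι → Type*}
    [∀ i, MeasurableSpace (Ω i)] {μ : ∀ i, Measure (Ω i)} [∀ i, IsProbabilityMeasure (μ i)]
    {f : ∀ i, Ω i → ℝ} {c : ι → ℝ≥0} (hf : ∀ i, Measurable (f i))
    (hsub : ∀ i, HasSubgaussianMGF (f i) (c i) (μ i)) :
    HasSubgaussianMGF (fun ω : ∀ i, Ω i => ∑ i, f i (ω i)) (∑ i, c i) (Measure.pi μ) := by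
  refine HasSubgaussianMGF.sum_of_iIndepFun
    (iIndepFun_pi (μ := μ) (X := f) fun i => (hf i).aemeasurable) fun i _ => ?_
  refine HasSubgaussianMGF.of_map (Y := Function.eval i) (X := f i)
    (measurable_pi_apply i).aemeasurable ?_
  rw [(measurePreserving_eval μ i).map_eq]
  exact hsub i

lemma hasSubgaussianMGF_const_mul_nnnorm {Ω : Type*} [MeasurableSpace Ω] {μ : Measure Ω}
    {f : Ω → ℝ} {c : ℝ≥0} (hf : HasSubgaussianMGF f c μ) (r : ℝ) :
    HasSubgaussianMGF (fun ω => r * f ω) (‖r‖₊ ^ 2 * c) μ := by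
  have hr : ‖r‖₊ ^ 2 = NNReal.mk (r ^ 2) (sq_nonneg r) := by
    apply NNReal.eq
    push_cast
    simp
  rw [hr]
  exact hf.const_mul r

lemma measurable_empirical {Y : Type*} [MeasurableSpace Y] {A : Set Y} (hA : MeasurableSet A)
    (n : ℕ) : Measurable fun x : Fin n → Y => empirical x A := by
  unfold empirical
  refine (Finset.measurable_sum _ fun i _ => ?_).div_const _
  exact (measurable_const.indicator hA).comp (measurable_pi_apply i)

lemma empirical_nonneg {Y : Type*} {n : ℕ} (x : Fin n → Y) (A : Set Y) : 0 ≤ empirical x A :=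
  div_nonneg (Finset.sum_nonneg fun _ _ => Set.indicator_nonneg (fun _ _ => zero_le_one) _)
    n.cast_nonneg

lemma empirical_le_one {Y : Type*} {n : ℕ} (x : Fin n → Y) (A : Set Y) : empirical x A ≤ 1 := by
  refine div_le_one_of_le₀ ?_ n.cast_nonneg
  calc ∑ i, A.indicator (fun _ => (1 : ℝ)) (x i) ≤ ∑ _i : Fin n, (1 : ℝ) :=
        Finset.sum_le_sum fun _ _ => Set.indicator_le_self' (fun _ _ => zero_le_one) _
    _ = n := by simp

/-- **Hoeffding's lemma** for empirical frequencies. -/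
lemma hasSubgaussianMGF_empirical {Y : Type*} [MeasurableSpace Y] (μ : Measure Y)
    [IsProbabilityMeasure μ] {A : Set Y} (hA : MeasurableSet A) {n : ℕ} (hn : 0 < n) :
    HasSubgaussianMGF (fun x : Fin n → Y => empirical x A - μ.real A) (1 / (4 * n))
      (Measure.pi fun _ => μ) := by
  have hmeas : Measurable (A.indicator fun _ => (1 : ℝ)) := measurable_const.indicator hA
  -- An indicator has range of length 1, hence parameter `1/4`; summing `n` copies and scaling by
  -- `1/n` gives `n * (1/4) / n ^ 2 = 1 / (4 * n)`.
  have hone : HasSubgaussianMGF (fun y => A.indicator (fun _ => (1 : ℝ)) y - μ.real A)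
      ((‖(1 : ℝ) - 0‖₊ / 2) ^ 2) μ := by
    have := hasSubgaussianMGF_of_mem_Icc (μ := μ) (a := 0) (b := 1) hmeas.aemeasurable
      (Filter.Eventually.of_forall fun y =>
        ⟨Set.indicator_nonneg (fun _ _ => zero_le_one) y,
          Set.indicator_le_self' (fun _ _ => zero_le_one) y⟩)
    simpa [integral_indicator hA] using this
  have hsum := hasSubgaussianMGF_const_mul_nnnorm (hasSubgaussianMGF_pi_sum
    (μ := fun _ : Fin n => μ) (fun _ => hmeas.sub_const _) fun _ => hone) ((n : ℝ)⁻¹)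
  have hn' : (n : ℝ) ≠ 0 := by positivity
  convert hsum using 1
  · funext x
    simp only [empirical, Finset.sum_sub_distrib, Finset.sum_const, Finset.card_univ,
      Fintype.card_fin, nsmul_eq_mul]
    field_simp
  · ext
    push_cast
    simp
    field_simp
    norm_num

/-- The set of labeled examples misclassified by `h`. -/
def misclassified {X : Type*} (h : Hypothesis X) : Set (X × Bool) := {z | h z.1 ≠ z.2}

lemma measurableSet_misclassified {X : Type*} [MeasurableSpace X] {h : Hypothesis X}
    (hh : Measurable h) : MeasurableSet (misclassified h) :=
  (measurableSet_eq_fun (hh.comp measurable_fst) measurable_snd).compl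

lemma empiricalRisk_eq_empirical {X : Type*} {m : ℕ} (z : Fin m → X × Bool) (h : Hypothesis X) :
    empiricalRisk z h = empirical z (misclassified h) := by
  classical
  simp [empiricalRisk, empirical, misclassified, Set.indicator_apply]

lemma Domain.risk_eq_joint {X : Type*} [MeasurableSpace X] (D : Domain X) {h : Hypothesis X}
    (hh : Measurable h) : D.risk h = D.joint.real (misclassified h) := by
  exact (map_measureReal_apply (measurable_id.prodMk D.measurable_label)
    (measurableSet_misclassified hh)).symm

/-- The deviation of the `α`-weighted empirical risk of a fixed hypothesis is sub-Gaussian. -/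
lemma hasSubgaussianMGF_weighted_empiricalRisk {X : Type*} [MeasurableSpace X] {M m : ℕ}
    (hm : 0 < m) (S : Fin M → Domain X) {h : Hypothesis X} (hh : Measurable h) (α : Fin M → ℝ) :
    HasSubgaussianMGF (fun z : Fin M → Fin m → X × Bool =>
        ∑ j, α j * (empirical (z j) (misclassified h) - (S j).joint.real (misclassified h)))
      (∑ j, ‖α j‖₊ ^ 2 * (1 / (4 * m) : ℝ≥0))
      (Measure.pi fun j => Measure.pi fun _ : Fin m => (S j).joint) :=
  hasSubgaussianMGF_pi_sum
    (f := fun j z => α j * (empirical z (misclassified h) - (S j).joint.real (misclassified h)))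
    (fun _ => ((measurable_empirical (measurableSet_misclassified hh) m).sub_const _).const_mul _)
    fun j => hasSubgaussianMGF_const_mul_nnnorm (hasSubgaussianMGF_empirical (S j).joint
      (measurableSet_misclassified hh) hm) (α j)

/-- **Hoeffding's inequality** for the `α`-weighted empirical risk of a fixed hypothesis. -/
lemma weighted_empiricalRisk_deviation {X : Type*} [MeasurableSpace X] {M m : ℕ}
    (hm : 0 < m) (S : Fin M → Domain X) {h : Hypothesis X} (hh : Measurable h) (α : Fin M → ℝ)
    {ε : ℝ} (hε : 0 ≤ ε) :
    (Measure.pi fun j => Measure.pi fun _ : Fin m => (S j).joint).real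
      {z | (∑ j, α j * (S j).risk h) + ε ≤ ∑ j, α j * empiricalRisk (z j) h} ≤
      Real.exp (-(2 * m * ε ^ 2) / ∑ j, α j ^ 2) := by
  have key := (hasSubgaussianMGF_weighted_empiricalRisk hm S hh α).measure_ge_le hε
  have hm' : (m : ℝ) ≠ 0 := by positivity
  convert key using 2
  · ext z
    simp only [Set.mem_ofPred_eq, empiricalRisk_eq_empirical, (S _).risk_eq_joint hh, mul_sub,
      Finset.sum_sub_distrib]
    constructor <;> intro _ <;> linarith
  · push_cast
    rw [← Finset.sum_mul]
    simp only [Real.norm_eq_abs, sq_abs]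
    -- For zero weights both exponents are divisions by zero, hence equal to `0`.
    by_cases h0 : ∑ j, α j ^ 2 = 0
    · simp [h0]
    · field_simp
      ring

/-- **Hoeffding's inequality** for the lower tail of an empirical frequency. -/
lemma empirical_lower_deviation {Y : Type*} [MeasurableSpace Y] (μ : Measure Y)
    [IsProbabilityMeasure μ] {A : Set Y} (hA : MeasurableSet A) {n : ℕ} (hn : 0 < n)
    {ε : ℝ} (hε : 0 ≤ ε) :
    (Measure.pi fun _ : Fin n => μ).real {x | empirical x A + ε ≤ μ.real A} ≤
      Real.exp (-(2 * n * ε ^ 2)) := by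
  have key := (hasSubgaussianMGF_empirical μ hA hn).neg.measure_ge_le hε
  have hn' : (n : ℝ) ≠ 0 := by positivity
  convert key using 2
  · ext x
    simp only [Set.mem_ofPred_eq, Pi.neg_apply]
    constructor <;> intro _ <;> linarith
  · push_cast
    field_simp
    ring

/-! ### Deterministic comparisons of risks and disagreements. -/

/-- Each member of the symmetric difference class bounds the empirical divergence from below. -/
lemma disagreement_le_divergence {X : Type*} {M m n : ℕ} {H : Set (Hypothesis X)}
    {h h' : Hypothesis X} (hh : h ∈ H) (hh' : h' ∈ H) {α : Fin M → ℝ}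
    (hα : α ∈ stdSimplex ℝ (Fin M)) (ω : Data X M m n) :
    empirical ω.2 {x | h x ≠ h' x} ≤
      (∑ j, α j * empirical (fun i => (ω.1 j i).1) {x | h x ≠ h' x}) +
        (1 / 2) * empiricalMixtureDivergence H α ω := by
  set P := mixture α fun j => empirical fun i => (ω.1 j i).1
  have hP (A : Set X) : 0 ≤ P A ∧ P A ≤ 1 := by
    refine ⟨Finset.sum_nonneg fun j _ => mul_nonneg (hα.1 j) (empirical_nonneg _ _), ?_⟩
    rw [← hα.2]
    exact Finset.sum_le_sum fun j _ => mul_le_of_le_one_right (hα.1 j) (empirical_le_one _ _)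
  -- A real supremum bounds its terms only if the family is bounded; here both frequencies lie in
  -- `[0, 1]`, as `α` is a convex combination.
  have hbdd : BddAbove (Set.range fun l : symmDiffClass H =>
      |P {x | l.1 x = true} - empirical ω.2 {x | l.1 x = true}|) := by
    refine ⟨1, ?_⟩
    rintro _ ⟨l, rfl⟩
    have h1 := hP {x | l.1 x = true}
    have h2 := empirical_nonneg ω.2 {x | l.1 x = true}
    have h3 := empirical_le_one ω.2 {x | l.1 x = true}
    exact abs_le.2 ⟨by linarith, by linarith⟩
  have hle := le_ciSup hbdd ⟨fun x => Bool.xor (h x) (h' x), h, hh, h', hh', fun _ => rfl⟩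
  have hset : {x | Bool.xor (h x) (h' x) = true} = {x | h x ≠ h' x} := by
    ext x; simp
  simp only [hset] at hle
  have habs := neg_abs_le (P {x | h x ≠ h' x} - empirical ω.2 {x | h x ≠ h' x})
  have hdiv : empiricalMixtureDivergence H α ω = 2 * ⨆ l : symmDiffClass H,
      |P {x | l.1 x = true} - empirical ω.2 {x | l.1 x = true}| := rfl
  have hPdef : P {x | h x ≠ h' x} =
      ∑ j, α j * empirical (fun i => (ω.1 j i).1) {x | h x ≠ h' x} := rfl
  linarith

/-- Two hypotheses disagree at most as often as they err, on every labeled sample. -/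
lemma empirical_disagreement_le {X : Type*} {m : ℕ} (z : Fin m → X × Bool)
    (h h' : Hypothesis X) :
    empirical (fun i => (z i).1) {x | h x ≠ h' x} ≤ empiricalRisk z h + empiricalRisk z h' := by
  classical
  rw [empirical, empiricalRisk, empiricalRisk, ← add_div, ← Finset.sum_add_distrib]
  refine div_le_div_of_nonneg_right (Finset.sum_le_sum fun i _ => ?_) m.cast_nonneg
  simp only [Set.indicator_apply, Set.mem_ofPred_eq]
  -- Whatever the label, two differing predictions cannot both match it.
  by_cases h1 : h (z i).1 = (z i).2 <;> by_cases h2 : h' (z i).1 = (z i).2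
  · simp [h1, h2]
  · split_ifs <;> simp_all
  · split_ifs <;> simp_all
  · split_ifs <;> simp_all

/-- The triangle inequality for risks. -/
lemma Domain.risk_le_add_disagreement {X : Type*} [MeasurableSpace X] (D : Domain X)
    (h h' : Hypothesis X) :
    D.risk h ≤ D.risk h' + D.marginal.real {x | h x ≠ h' x} := by
  refine le_trans (measureReal_mono ?_) (measureReal_union_le _ _)
  intro x hx
  by_cases hxx : h x = h' x
  · exact Or.inl (by simpa [hxx] using hx)
  · exact Or.inr hxx

/-- Every bound above the combined risk is beaten by some hypothesis of the class. -/
lemma exists_lt_combinedRisk_add {X : Type*} [MeasurableSpace X] {M : ℕ} {H : Set (Hypothesis X)}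
    (hH : H.Nonempty) (α : Fin M → ℝ) (S : Fin M → Domain X) (T : Domain X) {η : ℝ}
    (hη : 0 < η) :
    ∃ h ∈ H, (∑ j, α j * (S j).risk h) + T.risk h < combinedRisk H α S T + η := by
  have : Nonempty H := hH.to_subtype
  obtain ⟨h, hh⟩ := exists_lt_of_ciInf_lt (lt_add_of_pos_right (combinedRisk H α S T) hη)
  exact ⟨h.1, h.2, hh⟩

/-! ### Tail probabilities at the thresholds of the theorem. -/

lemma divergenceTerm_pos (d : ℕ) {n : ℕ} (hn : 0 < n) {δ : ℝ} (hδ : 0 < δ) (hδ1 : δ < 1) :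
    0 < divergenceTerm d n δ := by
  have hn1 : (1 : ℝ) ≤ n := by exact_mod_cast hn
  have h1 : 0 ≤ Real.log (2 * n) := Real.log_nonneg (by linarith)
  have h2 : 0 < Real.log (4 / δ) := Real.log_pos (by rw [lt_div_iff₀ hδ]; linarith)
  unfold divergenceTerm
  positivity

/-- The exponent is `-2 * (2 * d * log (2 * n) + log (4 / δ))`; dropping the nonnegative `d` term
and one copy of the logarithm leaves `log (δ / 4)`. -/
lemma exp_divergenceTerm_le (d : ℕ) {n : ℕ} (hn : 0 < n) {δ : ℝ} (hδ : 0 < δ) (hδ1 : δ < 1) :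
    Real.exp (-(2 * n * (divergenceTerm d n δ / 2) ^ 2)) ≤ δ / 4 := by
  have hn1 : (1 : ℝ) ≤ n := by exact_mod_cast hn
  have h1 : 0 ≤ d * Real.log (2 * n) :=
    mul_nonneg d.cast_nonneg (Real.log_nonneg (by linarith))
  have h2 : 0 < Real.log (4 / δ) := Real.log_pos (by rw [lt_div_iff₀ hδ]; linarith)
  have hsq : (divergenceTerm d n δ / 2) ^ 2 =
      (2 * d * Real.log (2 * n) + Real.log (4 / δ)) / n := by
    rw [divergenceTerm, mul_div_cancel_left₀ _ two_ne_zero, Real.sq_sqrt]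
    exact div_nonneg (by linarith) (by linarith)
  have hlog : Real.log (4 / δ) = -Real.log (δ / 4) := by rw [← Real.log_inv, inv_div]
  rw [hsq, ← Real.le_log_iff_exp_le (by positivity), mul_assoc,
    mul_div_cancel₀ _ (by positivity : (n : ℝ) ≠ 0)]
  linarith

/-- With `n = M * m`, the factor `M / n` in the squared term cancels the per-source sample size `m`,
and `∑ j, α j ^ 2` cancels too. What remains is `-8` times the logarithmic terms. -/
lemma exp_mixtureTerm_le {M : ℕ} (d : ℕ) {n : ℕ} (hn : 0 < n) (hMn : M ∣ n) {α : Fin M → ℝ}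
    (hα : 0 < ∑ j, α j ^ 2) {δ : ℝ} (hδ : 0 < δ) (hδ1 : δ < 1) :
    Real.exp (-(2 * ((n / M : ℕ) : ℝ) * mixtureTerm d n α δ ^ 2) / ∑ j, α j ^ 2) ≤ δ / 8 := by
  obtain ⟨m, rfl⟩ := hMn
  have hM : 0 < M := Nat.pos_of_mul_pos_right hn
  have hm : 0 < m := Nat.pos_of_mul_pos_left hn
  rw [Nat.mul_div_cancel_left m hM]
  have hM' : (0 : ℝ) < M := by exact_mod_cast hM
  have hm' : (0 : ℝ) < m := by exact_mod_cast hm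
  have hn0 : (0 : ℝ) ≤ (M * m : ℕ) := Nat.cast_nonneg _
  have h1 : 0 ≤ d * Real.log (2 * ((M * m : ℕ) + 1)) :=
    mul_nonneg d.cast_nonneg (Real.log_nonneg (by linarith))
  have h2 : 0 < Real.log (8 / δ) := Real.log_pos (by rw [lt_div_iff₀ hδ]; linarith)
  have hlog : Real.log (8 / δ) = -Real.log (δ / 8) := by rw [← Real.log_inv, inv_div]
  rw [← Real.le_log_iff_exp_le (by positivity), mixtureTerm, mul_pow, Real.sq_sqrt (mul_nonneg
    (div_nonneg (mul_nonneg hM'.le (by linarith)) hn0) hα.le)]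
  generalize Real.log (2 * ((M * m : ℕ) + 1)) = L at *
  have : -(2 * (m : ℝ) * (2 ^ 2 * (M * (2 * d * L + Real.log (8 / δ)) / (M * m : ℕ) *
      ∑ j, α j ^ 2))) / ∑ j, α j ^ 2 = -8 * (2 * d * L + Real.log (8 / δ)) := by
    push_cast
    field_simp
    norm_num
  rw [this]
  linarith

end DomainAdaptation

open DomainAdaptation in
theorem theorem1 {X : Type*} [MeasurableSpace X]
    (H : Set (Hypothesis X)) (hH : ∀ h ∈ H, Measurable h) (d : ℕ) (hd : vcDim H = d)
    (M n : ℕ) (hn : 0 < n) (hMn : M ∣ n)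
    (S : Fin M → Domain X) (T : Domain X)
    (δ : ℝ) (hδ : 0 < δ) (hδ1 : δ < 1) :
    ∀ h ∈ H, ∀ α ∈ stdSimplex ℝ (Fin M),
      ∃ E : Set (Data X M (n / M) n), MeasurableSet E ∧
        ENNReal.ofReal (1 - δ) ≤ dataLaw (n / M) n S T E ∧
        ∀ ω ∈ E,
          T.risk h ≤ (∑ j, α j * empiricalRisk (ω.1 j) h)
            + (1 / 2) * empiricalMixtureDivergence H α ω
            + combinedRisk H α S T + mixtureTerm d n α δ + divergenceTerm d n δ := by
  intro h hh α hα
  have hm : 0 < n / M := Nat.div_pos (Nat.le_of_dvd hn hMn) (Nat.pos_of_dvd_of_pos hMn hn)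
  have hVpos := divergenceTerm_pos d hn hδ hδ1
  have hBnonneg : 0 ≤ mixtureTerm d n α δ := by unfold mixtureTerm; positivity
  have hsq : 0 < ∑ j, α j ^ 2 := by
    refine (Finset.sum_nonneg fun j _ => sq_nonneg (α j)).lt_of_ne' fun h0 => ?_
    have hzero := (Finset.sum_eq_zero_iff_of_nonneg fun j _ => sq_nonneg (α j)).1 h0
    have hone := hα.2
    rw [Finset.sum_eq_zero fun j hj => pow_eq_zero_iff two_ne_zero |>.1 (hzero j hj)] at hone
    exact zero_ne_one hone
  -- The infimum need not be attained, so half of the divergence term is spent here and the other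
  -- half in `G`.
  obtain ⟨g, hg, hgrisk⟩ := exists_lt_combinedRisk_add ⟨h, hh⟩ α S T (half_pos hVpos)
  have hgm := hH g hg
  have hA : MeasurableSet {x | h x ≠ g x} := (measurableSet_eq_fun (hH h hh) hgm).compl
  set F : Set (Fin M → Fin (n / M) → X × Bool) :=
    {z | (∑ j, α j * (S j).risk g) + mixtureTerm d n α δ ≤ ∑ j, α j * empiricalRisk (z j) g}
    with hF
  set G : Set (Fin n → X) := {x | empirical x {x | h x ≠ g x} + divergenceTerm d n δ / 2 ≤
    T.marginal.real {x | h x ≠ g x}} with hG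
  have hFm : MeasurableSet F := by
    simp only [hF, empiricalRisk_eq_empirical]
    refine measurableSet_le measurable_const (Finset.measurable_sum _ fun j _ => ?_)
    exact ((measurable_empirical (measurableSet_misclassified hgm) _).comp
      (measurable_pi_apply j)).const_mul _
  have hGm : MeasurableSet G :=
    measurableSet_le ((measurable_empirical hA n).add_const _) measurable_const
  have hFle := (weighted_empiricalRisk_deviation hm S hgm α hBnonneg).trans
    (exp_mixtureTerm_le d hn hMn hsq hδ hδ1)
  have hGle := (empirical_lower_deviation T.marginal hA hn (half_pos hVpos).le).trans
    (exp_divergenceTerm_le d hn hδ hδ1)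
  have : IsProbabilityMeasure (dataLaw (n / M) n S T) := by unfold dataLaw; infer_instance
  have hmeas : MeasurableSet (Prod.fst ⁻¹' F ∪ Prod.snd ⁻¹' G : Set (Data X M (n / M) n)) :=
    (measurable_fst hFm).union (measurable_snd hGm)
  refine ⟨(Prod.fst ⁻¹' F ∪ Prod.snd ⁻¹' G)ᶜ, hmeas.compl, ?_, ?_⟩
  · have hF' : (dataLaw (n / M) n S T).real (Prod.fst ⁻¹' F) ≤ δ / 8 := by
      rwa [dataLaw, measurePreserving_fst.measureReal_preimage hFm.nullMeasurableSet]
    have hG' : (dataLaw (n / M) n S T).real (Prod.snd ⁻¹' G) ≤ δ / 4 := by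
      rwa [dataLaw, measurePreserving_snd.measureReal_preimage hGm.nullMeasurableSet]
    have hu := measureReal_union_le (μ := dataLaw (n / M) n S T) (Prod.fst ⁻¹' F) (Prod.snd ⁻¹' G)
    rw [← ofReal_measureReal, probReal_compl_eq_one_sub hmeas]
    -- The failure probability is at most `δ / 8 + δ / 4 ≤ δ`.
    exact ENNReal.ofReal_le_ofReal (by linarith)
  · intro ω hω
    simp only [Set.mem_compl_iff, Set.mem_union, Set.mem_preimage, hF, hG, Set.mem_ofPred_eq,
      not_or, not_le] at hω
    have h1 := T.risk_le_add_disagreement h g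
    have h2 := disagreement_le_divergence hh hg hα ω
    have h3 : ∑ j, α j * empirical (fun i => (ω.1 j i).1) {x | h x ≠ g x} ≤
        (∑ j, α j * empiricalRisk (ω.1 j) h) + ∑ j, α j * empiricalRisk (ω.1 j) g := by
      rw [← Finset.sum_add_distrib]
      refine Finset.sum_le_sum fun j _ => ?_
      rw [← mul_add]
      exact mul_le_mul_of_nonneg_left (empirical_disagreement_le _ h g) (hα.1 j)
    linarith [hω.1, hω.2]
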